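/- Let $\mathcal L:\mathbb C^8\to\mathbb R^6$ be $\mathcal L(z)=-\tfrac12\bigl(|z_1|^2+|z_5|^2-6,\ |z_2|^2+|z_5|^2+|z_7|^2-10,\ |z_3|^2+|z_7|^2-6,\ |z_4|^2-|z_5|^2+|z_7|^2-4,\ |z_5|^2-|z_6|^2+|z_7|^2-2,\ |z_5|^2-|z_7|^2+|z_8|^2-4\bigr)$, the momentum map of a $\mathbb T^6$-action on $\mathbb C^8$, and let $M=\mathcal L^{-1}(0)/\mathbb T^6$ be the symplectic quotient. On $M$ put $J=\tfrac12|z_1|^2$, $H=\tfrac12|z_3|^2$, $$\gamma_1=\tfrac1{50}\Re(\overline{z_2z_3z_4}z_6z_7z_8),\quad \gamma_2=\tfrac1{50}|z_5|^4|z_4|^4,\quad \gamma_3=\tfrac1{50}|z_4|^4|z_7|^4,\quad \gamma_4=\tfrac1{100}|z_5|^4|z_7|^4,$$ and $H_t=(1-2t_1)H+\sum_{j=1}^4t_j\gamma_j$ for $t\in\mathbb R^4$. A point is singular for $(J,H_t)$ if the differential of $(J,H_t)$ there has rank less than $2$, and singular of rank one if this rank is $1$. Let $U_1\subset M$ be the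 set of $[z]$ with $z_3,\dots,z_8\ne0$. It is parametrised by $\varphi_1(z_1,z_2)=[z_1,z_2,x_3,\dots,x_8]$, where $x_3,\dots,x_8>0$ are the square roots of $2-|z_1|^2+|z_2|^2$, $6-2|z_1|^2+|z_2|^2$, $6-|z_1|^2$, $8-|z_2|^2$, $4+|z_1|^2-|z_2|^2$, $2+2|z_1|^2-|z_2|^2$, and $\varphi_1^{-1}(U_1)\subset\mathbb C^2$ is the set where these six expressions are positive. Let $D_1=\{(|z_1|,|z_2|) : (z_1,z_2)\in\varphi_1^{-1}(U_1)\}$ and $P_1(r_1,r_2,\vartheta_1,\vartheta_2)=(r_1e^{i\vartheta_1},r_2e^{i\vartheta_2})$ for $(r_1,r_2)\in D_1$. Define $$S(r_1,r_2)=(8-r_2^2)(2+2r_1^2-r_2^2)(6-2r_1^2+r_2^2)(4+r_1^2-r_2^2)(2-r_1^2+r_2^2),\qquad \overline\Omega(r_1,r_2)=\tfrac{r_2}{50}\sqrt{S(r_1,r_2)},$$ $$\Gamma_t=(1-2t_1)\tfrac{2-r_1^2+r_2^2}{2}+\tfrac{t_2}{50}(6-r_1^2)^2(6-2r_1^2+r_2^2)^2+\tfrac{t_3}{50}(6-2r_1^2+r_2^2)^2(4+r_1^2-r_2^2)^2+\tfrac{t_4}{100}(6-r_1^2)^2(4+r_1^2-r_2^2)^2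 .$$ Let $t_1\neq0$. Then: 1. $\varphi_1$ maps $\varphi_1^{-1}(U_1)$ onto $U_1$, and at $(\varphi_1\circ P_1)(r_1,r_2,\vartheta_1,\vartheta_2)$ one has $J=r_1^2/2$, $\gamma_1=\cos\vartheta_2\,\overline\Omega(r_1,r_2)$ and $H_t=\Gamma_t(r_1,r_2)+t_1\cos\vartheta_2\,\overline\Omega(r_1,r_2)$. 2. If $\varphi_1(x+iy,u+iv)\in U_1$ is a singular point of $(J,H_t)$ with $dJ\ne0$, then $v=0$; in polar coordinates with $\vartheta_2\in(-\pi,\pi]$, $\vartheta_2\in\{0,\pi\}$. 3. If $(r_1,r_2)\in D_1$, $r_1\neq0$ and $$(\partial_{r_2}\Gamma_t(r_1,r_2))^2-t_1^2(\partial_{r_2}\overline\Omega(r_1,r_2))^2=0,\qquad(*)$$ then for at least one $\vartheta_2\in\{0,\pi\}$ the point $(\varphi_1\circ P_1)(r_1,r_2,\vartheta_1,\vartheta_2)$ is a singular point of rank one for every $\vartheta_1$. More precisely, for $(r_1,r_2)\in D_1$ with $r_1\ne0$, any $\vartheta_1$ and $\vartheta_2\in\{0,\pi\}$, that point is singular of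 rank one if and only if $\partial_{r_2}\Gamma_t(r_1,r_2)+t_1\cos\vartheta_2\,\partial_{r_2}\overline\Omega(r_1,r_2)=0$. 4. Conversely, every singular point $\varphi_1(z_1,z_2)\in U_1$ with $dJ\ne0$ has rank one, $z_1\neq0$, and $(r_1,r_2)=(|z_1|,|z_2|)$ solves $(*)$. 5. Equation $(*)$ is equivalent to a polynomial equation on $D_1$: $S>0$ on $D_1$, and there is a nonzero polynomial $Q_t\in\mathbb R[r_1,r_2]$ such that $S$ times the left-hand side of $(*)$ equals $Q_t(r_1,r_2)$ on $D_1$. -/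

import Mathlib

open scoped ComplexConjugate

noncomputable section

namespace Octagon

/-- The ambient space `ℂ⁸`; the coordinate written `z_{k+1}` in comments is `z k`. -/
abbrev C8 : Type := Fin 8 → ℂ

/-- The integer weights of the torus `𝕋⁶` acting on `ℂ⁸`. -/
def weight : Fin 6 → Fin 8 → ℤ :=
  ![![1, 0, 0, 0, 1, 0, 0, 0],
    ![0, 1, 0, 0, 1, 0, 1, 0],
    ![0, 0, 1, 0, 0, 0, 1, 0],
    ![0, 0, 0, 1, -1, 0, 1, 0],
    ![0, 0, 0, 0, 1, -1, 1, 0],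
    ![0, 0, 0, 0, 1, 0, -1, 1]]

/-- The constants in the six manifold equations. -/
def level : Fin 6 → ℝ := ![6, 10, 6, 4, 2, 4]

/-- The momentum map `𝓛 : ℂ⁸ → ℝ⁶` of the `𝕋⁶`-action: its components are
`-½ (∑ j, weight k j * |z_j|² - level k)`. -/
def momentL (z : C8) : Fin 6 → ℝ :=
  fun k => -(1 / 2) * ((∑ j, (weight k j : ℝ) * ‖z j‖ ^ 2) - level k)

/-- The `𝕋⁶`-action on `ℂ⁸` generated by `momentL`, with `𝕋⁶ = (S¹)⁶`. -/
def torusAct (θ : Fin 6 → Circle) (z : C8) : C8 :=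
  fun j => ((∏ k, θ k ^ weight k j : Circle) : ℂ) * z j

lemma torusAct_one (z : C8) : torusAct 1 z = z := by
  funext j; simp [torusAct]

lemma torusAct_mul (θ η : Fin 6 → Circle) (z : C8) :
    torusAct (θ * η) z = torusAct θ (torusAct η z) := by
  funext j
  simp only [torusAct, Pi.mul_apply, mul_zpow, Finset.prod_mul_distrib, Circle.coe_mul, mul_assoc]

lemma norm_torusAct (θ : Fin 6 → Circle) (z : C8) (j : Fin 8) :
    ‖torusAct θ z j‖ = ‖z j‖ := by
  simp only [torusAct, norm_mul, Circle.norm_coe, one_mul]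

lemma momentL_torusAct (θ : Fin 6 → Circle) (z : C8) :
    momentL (torusAct θ z) = momentL z := by
  funext k; simp only [momentL, norm_torusAct]

/-- The zero level `𝓛⁻¹(0)`. -/
def ZeroLevel : Type := {z : C8 // momentL z = 0}

/-- Two points of the zero level are equivalent if they lie on one `𝕋⁶`-orbit. -/
def orbitSetoid : Setoid ZeroLevel where
  r z w := ∃ θ : Fin 6 → Circle, torusAct θ z.1 = w.1
  iseqv :=
    { refl := fun z => ⟨1, torusAct_one z.1⟩
      symm := by
        rintro z w ⟨θ, h⟩
        exact ⟨θ⁻¹, by rw [← h, ← torusAct_mul, inv_mul_cancel, torusAct_one]⟩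
      trans := by
        rintro z w u ⟨θ, h⟩ ⟨η, h'⟩
        exact ⟨η * θ, by rw [torusAct_mul, h, h']⟩ }

/-- The symplectic quotient `M = 𝓛⁻¹(0) / 𝕋⁶`. -/
def OctM : Type := Quotient orbitSetoid

/-- The class `[z]` in `M` of a point of the zero level. -/
def toM (z : ZeroLevel) : OctM := Quotient.mk orbitSetoid z

/-- Invariance of a map on `ℂ⁸` under the `𝕋⁶`-action. -/
def Invariant {E : Type} (F : C8 → E) : Prop :=
  ∀ (θ : Fin 6 → Circle) (z : C8), F (torusAct θ z) = F z

/-- The map `M → E` induced by an invariant map on `ℂ⁸`. -/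
def descend {E : Type} (F : C8 → E) (hF : Invariant F) : OctM → E :=
  Quotient.lift (fun z : ZeroLevel => F z.1) (by
    rintro z w ⟨θ, h⟩
    show F z.1 = F w.1
    rw [← h, hF])

/-- The tangent space at `z` of the level set of `momentL` through `z`. -/
def tangentLevel (z : C8) : Submodule ℝ C8 :=
  LinearMap.ker (fderiv ℝ momentL z).toLinearMap

/-- The rank at `z` of the differential of `F` restricted to the level set of `momentL`. -/
def levelRank {E : Type} [NormedAddCommGroup E] [NormedSpace ℝ E] (F : C8 → E) (z : C8) : ℕ :=
  Module.finrank ℝ ((tangentLevel z).map (fderiv ℝ F z).toLinearMap)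

/-- The action of a torus element as a real linear automorphism. -/
def torusEquiv (θ : Fin 6 → Circle) : C8 ≃L[ℝ] C8 :=
  LinearEquiv.toContinuousLinearEquiv
    { toFun := torusAct θ
      invFun := torusAct θ⁻¹
      left_inv := fun z => by rw [← torusAct_mul, inv_mul_cancel, torusAct_one]
      right_inv := fun z => by rw [← torusAct_mul, mul_inv_cancel, torusAct_one]
      map_add' := fun z w => by funext j; simp only [torusAct, Pi.add_apply, mul_add]
      map_smul' := fun c z => by
        funext j
        simp only [torusAct, Pi.smul_apply, RingHom.id_apply, Complex.real_smul]
        ring }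

lemma fderiv_torusAct {E : Type} [NormedAddCommGroup E] [NormedSpace ℝ E] {F : C8 → E}
    (hF : Invariant F) (θ : Fin 6 → Circle) (z : C8) :
    fderiv ℝ F z = (fderiv ℝ F (torusAct θ z)).comp (torusEquiv θ : C8 →L[ℝ] C8) := by
  have h := (torusEquiv θ).comp_right_fderiv (f := F) (x := z)
  have h2 : F ∘ (torusEquiv θ) = F := funext fun w => hF θ w
  rw [h2] at h
  exact h

lemma levelRank_torusAct {E : Type} [NormedAddCommGroup E] [NormedSpace ℝ E] {F : C8 → E}
    (hF : Invariant F) (θ : Fin 6 → Circle) (z : C8) :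
    levelRank F (torusAct θ z) = levelRank F z := by
  have hL : Invariant momentL := momentL_torusAct
  have key : (tangentLevel (torusAct θ z)).map (fderiv ℝ F (torusAct θ z)).toLinearMap
      = (tangentLevel z).map (fderiv ℝ F z).toLinearMap := by
    ext y
    simp only [Submodule.mem_map, tangentLevel, LinearMap.mem_ker]
    constructor
    · rintro ⟨w, hw, rfl⟩
      refine ⟨(torusEquiv θ).symm w, ?_, ?_⟩
      · rw [fderiv_torusAct hL θ z]
        simpa using hw
      · rw [fderiv_torusAct hF θ z]
        simp
    · rintro ⟨w, hw, rfl⟩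
      refine ⟨torusEquiv θ w, ?_, ?_⟩
      · rw [fderiv_torusAct hL θ z] at hw
        simpa using hw
      · rw [fderiv_torusAct hF θ z]
        simp
  unfold levelRank
  rw [key]

/-- The rank at a point `[z]` of `M` of the differential of the map `M → E` induced by `F`.
The quotient map from the zero level to `M` is a submersion, so `T_[z] M` is the tangent space
of the zero level at `z` modulo the orbit directions (on which the differential of an invariant
map vanishes); hence this is the rank of the differential of `F` restricted to
`ker d𝓛(z)`. It does not depend on the representative `z`. -/
def rankAt {E : Type} [NormedAddCommGroup E] [NormedSpace ℝ E] (F : C8 → E) (hF : Invariant F) :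
    OctM → ℕ :=
  Quotient.lift (fun z : ZeroLevel => levelRank F z.1) (by
    rintro z w ⟨θ, h⟩
    show levelRank F z.1 = levelRank F w.1
    rw [← h, levelRank_torusAct hF])

/-- `J = |z₁|² / 2` on `ℂ⁸`. -/
def preJ (z : C8) : ℝ := ‖z 0‖ ^ 2 / 2

/-- `H = |z₃|² / 2` on `ℂ⁸`. -/
def preH (z : C8) : ℝ := ‖z 2‖ ^ 2 / 2

/-- The perturbation terms `γ₁, γ₂, γ₃, γ₄` on `ℂ⁸`. -/
def preGamma (z : C8) : Fin 4 → ℝ :=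
  ![1 / 50 * (conj (z 1 * z 2 * z 3) * z 5 * z 6 * z 7).re,
    1 / 50 * (‖z 4‖ ^ 4 * ‖z 3‖ ^ 4),
    1 / 50 * (‖z 3‖ ^ 4 * ‖z 6‖ ^ 4),
    1 / 100 * (‖z 4‖ ^ 4 * ‖z 6‖ ^ 4)]

/-- `H_t = (1 - 2 t₁) H + ∑ t_j γ_j` on `ℂ⁸`. -/
def preHt (t : Fin 4 → ℝ) (z : C8) : ℝ :=
  (1 - 2 * t 0) * preH z + ∑ j, t j * preGamma z j

/-- The pair `(J, H_t)` on `ℂ⁸`. -/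
def preF (t : Fin 4 → ℝ) (z : C8) : ℝ × ℝ := (preJ z, preHt t z)

lemma preJ_invariant : Invariant preJ := fun θ z => by
  simp only [preJ, norm_torusAct]

lemma phase_cancel (θ : Fin 6 → Circle) :
    conj (((∏ k, θ k ^ weight k 1 : Circle) : ℂ) * ((∏ k, θ k ^ weight k 2 : Circle) : ℂ) *
        ((∏ k, θ k ^ weight k 3 : Circle) : ℂ)) *
      ((∏ k, θ k ^ weight k 5 : Circle) : ℂ) * ((∏ k, θ k ^ weight k 6 : Circle) : ℂ) *
      ((∏ k, θ k ^ weight k 7 : Circle) : ℂ) = 1 := by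
  rw [← Circle.coe_mul, ← Circle.coe_mul, ← Circle.coe_inv_eq_conj, ← Circle.coe_mul,
    ← Circle.coe_mul, ← Circle.coe_mul, ← Circle.coe_one]
  congr 1
  simp [Fin.prod_univ_six, weight]
  generalize θ 1 = b, θ 2 = c, θ 3 = d, θ 4 = e, θ 5 = f
  have e1 : (d⁻¹ * (c⁻¹ * b⁻¹)) * e⁻¹ * (b * c * d * e * f⁻¹) * f = 1 := by
    rw [show (d⁻¹ * (c⁻¹ * b⁻¹)) * e⁻¹ * (b * c * d * e * f⁻¹) * f
      = (b⁻¹ * b) * (c⁻¹ * c) * (d⁻¹ * d) * (e⁻¹ * e) * (f⁻¹ * f) by ac_rfl]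
    simp
  exact e1

lemma preGamma_invariant : Invariant preGamma := fun θ z => by
  have h : conj (torusAct θ z 1 * torusAct θ z 2 * torusAct θ z 3) * torusAct θ z 5 *
      torusAct θ z 6 * torusAct θ z 7 = conj (z 1 * z 2 * z 3) * z 5 * z 6 * z 7 := by
    have hp := phase_cancel θ
    simp only [torusAct, map_mul] at hp ⊢
    linear_combination (conj (z 1) * conj (z 2) * conj (z 3) * z 5 * z 6 * z 7) * hp
  simp only [preGamma, norm_torusAct, h]

lemma preHt_invariant (t : Fin 4 → ℝ) : Invariant (preHt t) := fun θ z => by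
  simp only [preHt, preH, norm_torusAct, preGamma_invariant θ z]

lemma preF_invariant (t : Fin 4 → ℝ) : Invariant (preF t) := fun θ z => by
  simp only [preF, preJ_invariant θ z, preHt_invariant t θ z]

/-- `γ = (γ₁, γ₂, γ₃, γ₄)` as a map on `M`. -/
def gammaM : OctM → Fin 4 → ℝ := descend preGamma preGamma_invariant

/-- `J : M → ℝ`. -/
def JM : OctM → ℝ := descend preJ preJ_invariant

/-- `H_t : M → ℝ`. -/
def HtM (t : Fin 4 → ℝ) : OctM → ℝ := descend (preHt t) (preHt_invariant t)

/-- `dJ(p) ≠ 0`, i.e. the differential of `J : M → ℝ` at `p` has nonzero rank. -/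
def dJNonzero (p : OctM) : Prop := rankAt preJ preJ_invariant p ≠ 0

/-- The rank at `p` of the differential of `F_t = (J, H_t) : M → ℝ²`. -/
def rankF (t : Fin 4 → ℝ) (p : OctM) : ℕ := rankAt (preF t) (preF_invariant t) p

/-- `p` is a singular point of `(J, H_t)`: the rank of the differential is not maximal. -/
def IsSingular (t : Fin 4 → ℝ) (p : OctM) : Prop := rankF t p < 2

/-- `p` is a singular point of rank one of `(J, H_t)`. -/
def IsRankOneSingular (t : Fin 4 → ℝ) (p : OctM) : Prop := rankF t p = 1

/-- The open set `U₁` of `M` on which `z₃, …, z₈` do not vanish. -/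
def U1 : Set OctM := {p | ∃ z : ZeroLevel, toM z = p ∧ ∀ j : Fin 8, 2 ≤ j → z.1 j ≠ 0}

/-- The radicands `|z₃|², …, |z₈|²` in terms of `a = |z₁|²`, `b = |z₂|²`. -/
def radicand (a b : ℝ) : Fin 6 → ℝ :=
  ![2 - a + b, 6 - 2 * a + b, 6 - a, 8 - b, 4 + a - b, 2 + 2 * a - b]

/-- The coordinate domain `φ₁⁻¹(U₁)` in `ℂ²`. -/
def V1 : Set (ℂ × ℂ) := {w | ∀ k, 0 < radicand (‖w.1‖ ^ 2) (‖w.2‖ ^ 2) k}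

/-- The representative in `ℂ⁸` of the point with coordinates `w = (x + iy, u + iv)`. -/
def chartRep (w : ℂ × ℂ) : C8 :=
  ![w.1, w.2,
    (√(radicand (‖w.1‖ ^ 2) (‖w.2‖ ^ 2) 0) : ℝ), (√(radicand (‖w.1‖ ^ 2) (‖w.2‖ ^ 2) 1) : ℝ),
    (√(radicand (‖w.1‖ ^ 2) (‖w.2‖ ^ 2) 2) : ℝ), (√(radicand (‖w.1‖ ^ 2) (‖w.2‖ ^ 2) 3) : ℝ),
    (√(radicand (‖w.1‖ ^ 2) (‖w.2‖ ^ 2) 4) : ℝ), (√(radicand (‖w.1‖ ^ 2) (‖w.2‖ ^ 2) 5) : ℝ)]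

lemma momentL_chartRep {w : ℂ × ℂ} (hw : w ∈ V1) : momentL (chartRep w) = 0 := by
  have h0 := hw 0
  have h1 := hw 1
  have h2 := hw 2
  have h3 := hw 3
  have h4 := hw 4
  have h5 := hw 5
  simp [radicand] at h0 h1 h2 h3 h4 h5
  funext k
  fin_cases k <;>
    simp [momentL, weight, level, chartRep, radicand, Fin.sum_univ_eight] <;>
    (try rw [Real.sq_sqrt (by linarith)]) <;> (try rw [Real.sq_sqrt (by linarith)]) <;>
    (try rw [Real.sq_sqrt (by linarith)]) <;> ring

/-- The chart `φ₁ : φ₁⁻¹(U₁) → M`. -/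
def phi1 (w : V1) : OctM := toM ⟨chartRep w.1, momentL_chartRep w.2⟩

/-- The domain `D₁` of the radii: the image of `φ₁⁻¹(U₁)` under `(z₁, z₂) ↦ (|z₁|, |z₂|)`. -/
def D1 : Set (ℝ × ℝ) := (fun w : ℂ × ℂ => (‖w.1‖, ‖w.2‖)) '' V1

/-- Polar coordinates `P₁(r₁, r₂, ϑ₁, ϑ₂)`. -/
def polar1 (r : ℝ × ℝ) (ϑ₁ ϑ₂ : ℝ) : ℂ × ℂ :=
  (r.1 * Real.cos ϑ₁ + Complex.I * (r.1 * Real.sin ϑ₁),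
    r.2 * Real.cos ϑ₂ + Complex.I * (r.2 * Real.sin ϑ₂))

lemma norm_polar_aux (r ϑ : ℝ) :
    ‖(r : ℂ) * Real.cos ϑ + Complex.I * (r * Real.sin ϑ)‖ ^ 2 = r ^ 2 := by
  rw [← Complex.normSq_eq_norm_sq, Complex.normSq_apply]
  simp [-Complex.ofReal_cos, -Complex.ofReal_sin]
  nlinarith [Real.sin_sq_add_cos_sq ϑ]

lemma polar1_mem {r : ℝ × ℝ} (hr : r ∈ D1) (ϑ₁ ϑ₂ : ℝ) : polar1 r ϑ₁ ϑ₂ ∈ V1 := by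
  obtain ⟨w, hw, rfl⟩ := hr
  intro k
  simp only [polar1, norm_polar_aux]
  exact hw k

/-- `φ₁ ∘ P₁` at `(r₁, r₂, ϑ₁, ϑ₂)` with `(r₁, r₂) ∈ D₁`. -/
def phiPolar (r : D1) (ϑ₁ ϑ₂ : ℝ) : OctM := phi1 ⟨polar1 r.1 ϑ₁ ϑ₂, polar1_mem r.2 ϑ₁ ϑ₂⟩

/-- `(8 - r₂²)(2 + 2r₁² - r₂²)(6 - 2r₁² + r₂²)(4 + r₁² - r₂²)(2 - r₁² + r₂²)`. -/
def fiveProd (r₁ r₂ : ℝ) : ℝ :=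
  (8 - r₂ ^ 2) * (2 + 2 * r₁ ^ 2 - r₂ ^ 2) * (6 - 2 * r₁ ^ 2 + r₂ ^ 2) *
    (4 + r₁ ^ 2 - r₂ ^ 2) * (2 - r₁ ^ 2 + r₂ ^ 2)

/-- The function `Ω̄`. -/
def OmegaBar (r₁ r₂ : ℝ) : ℝ := r₂ / 50 * √(fiveProd r₁ r₂)

/-- The function `Γ_t`. -/
def GammaT (t : Fin 4 → ℝ) (r₁ r₂ : ℝ) : ℝ :=
  (1 - 2 * t 0) * ((2 - r₁ ^ 2 + r₂ ^ 2) / 2)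
    + t 1 / 50 * ((6 - r₁ ^ 2) ^ 2 * (6 - 2 * r₁ ^ 2 + r₂ ^ 2) ^ 2)
    + t 2 / 50 * ((6 - 2 * r₁ ^ 2 + r₂ ^ 2) ^ 2 * (4 + r₁ ^ 2 - r₂ ^ 2) ^ 2)
    + t 3 / 100 * ((6 - r₁ ^ 2) ^ 2 * (4 + r₁ ^ 2 - r₂ ^ 2) ^ 2)

/-- `∂_{r₂} Γ_t`. -/
def dGammaT (t : Fin 4 → ℝ) (r₁ r₂ : ℝ) : ℝ := deriv (fun s => GammaT t r₁ s) r₂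

/-- `∂_{r₂} Ω̄`. -/
def dOmegaBar (r₁ r₂ : ℝ) : ℝ := deriv (fun s => OmegaBar r₁ s) r₂

/-- The expression `(∂_{r₂} Γ_t)² - t₁² (∂_{r₂} Ω̄)²`. -/
def singExpr (t : Fin 4 → ℝ) (r₁ r₂ : ℝ) : ℝ :=
  dGammaT t r₁ r₂ ^ 2 - t 0 ^ 2 * dOmegaBar r₁ r₂ ^ 2

end Octagon

end

open Octagon

noncomputable section

namespace Octagon

/-! The rank on `M` is the rank of the differential restricted to `ker d𝓛`, and there the six
momentum relations express the variation of every `|z_j|²` through those of `|z₁|²` and `|z₂|²`. In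
the chart `dJ ≠ 0` forces `z₁ ≠ 0`; conversely, if `z₁ ≠ 0`, some tangent vector changes `J`, so the
rank is at least one, and it is one exactly when `dH_t` vanishes on `ker d𝓛 ∩ ker dJ`.

Write `z₂ = u + iv` at a chart representative, where `z₃, …, z₈` are positive. Rotating `z₃` alone
fixes all moduli and changes only `γ₁`, at a rate that is a nonzero multiple of `v`. As `t₁ ≠ 0`,
singular points have `v = 0` (`levelRank_eq_two_of_im_ne_zero`). If `v = 0`, then on `ker d𝓛 ∩ ker
dJ` the number `√S · dH_t(k)` is `Re k₂` times one function of `|z₁|` and `u`, namely `critFun`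
(`sqrt_fiveProd_mul_fderiv_preHt`); the singular points are its zeros.

For `u = ε r₂` with `ε = cos ϑ₂ = ±1`, `critFun` vanishes exactly when `∂Γ_t + t₁ ε ∂Ω̄` does
(`critFun_eq_zero_iff`). The left-hand side of the equation for singular points is the product of
these two factors. Since `√S ∂Ω̄` is a polynomial, multiplying that product by `S` gives a
polynomial. -/

/-! ### Differentials of `𝓛`, `J` and `H_t` on `ℂ⁸` -/

/-- Half the derivative of `‖z j‖ ^ 2` in the direction `h`. -/
def halfDNormSq (z h : C8) (j : Fin 8) : ℝ := (z j).re * (h j).re + (z j).im * (h j).im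

lemma hasDerivAt_line_coord (z h : C8) (j : Fin 8) :
    HasDerivAt (fun s : ℝ => (z + s • h) j) (h j) 0 := by
  have h1 : HasDerivAt (fun s : ℝ => z j + s • h j) ((1 : ℝ) • h j) 0 :=
    ((hasDerivAt_id (0 : ℝ)).smul_const (h j)).const_add (z j)
  simpa using h1

lemma normSq_coord (z : C8) (j : Fin 8) : ‖z j‖ ^ 2 = (z j).re ^ 2 + (z j).im ^ 2 := by
  rw [← Complex.normSq_eq_norm_sq, Complex.normSq_apply]; ring

lemma hasDerivAt_line_normSq (z h : C8) (j : Fin 8) :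
    HasDerivAt (fun s : ℝ => ‖(z + s • h) j‖ ^ 2) (2 * halfDNormSq z h j) 0 := by
  have h0 := hasDerivAt_line_coord z h j
  have h1 : HasDerivAt (fun s : ℝ => ((z + s • h) j).re) (h j).re 0 :=
    Complex.reCLM.hasFDerivAt.comp_hasDerivAt (0 : ℝ) h0
  have h2 : HasDerivAt (fun s : ℝ => ((z + s • h) j).im) (h j).im 0 :=
    Complex.imCLM.hasFDerivAt.comp_hasDerivAt (0 : ℝ) h0
  simp only [normSq_coord]
  refine ((h1.pow 2).add (h2.pow 2)).congr_deriv ?_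
  simp [halfDNormSq]; ring

lemma differentiable_normSq_coord (j : Fin 8) : Differentiable ℝ (fun z : C8 => ‖z j‖ ^ 2) := by
  have : Differentiable ℝ (fun z : C8 => z j) := by fun_prop
  exact this.norm_sq ℝ

lemma norm_pow_four (c : ℂ) : ‖c‖ ^ 4 = (‖c‖ ^ 2) ^ 2 := by ring

/-- Reduces each differential to a one-variable derivative along a real line; differentiability has
to be known separately. -/
lemma fderiv_apply_of_line {E : Type} [NormedAddCommGroup E] [NormedSpace ℝ E] {F : C8 → E}
    {z h : C8} {d : E} (hF : DifferentiableAt ℝ F z)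
    (hd : HasDerivAt (fun s : ℝ => F (z + s • h)) d 0) : fderiv ℝ F z h = d := by
  rw [← hF.lineDeriv_eq_fderiv]
  exact HasLineDerivAt.lineDeriv hd

lemma differentiable_momentL : Differentiable ℝ momentL := by
  refine differentiable_pi.2 fun k => ?_
  have := differentiable_normSq_coord
  simp only [momentL]
  fun_prop

lemma fderiv_momentL (z h : C8) (k : Fin 6) :
    fderiv ℝ momentL z h k = -∑ j, (weight k j : ℝ) * halfDNormSq z h j := by
  have key : fderiv ℝ momentL z h = fun k => -∑ j, (weight k j : ℝ) * halfDNormSq z h j := by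
    refine fderiv_apply_of_line (differentiable_momentL z) (hasDerivAt_pi.2 fun k => ?_)
    have h1 := HasDerivAt.fun_sum (u := Finset.univ) fun j _ =>
      (hasDerivAt_line_normSq z h j).const_mul (weight k j : ℝ)
    refine ((h1.sub_const (level k)).const_mul (-(1 / 2))).congr_deriv ?_
    rw [Finset.mul_sum, ← Finset.sum_neg_distrib]
    exact Finset.sum_congr rfl fun j _ => by ring
  rw [key]

lemma mem_tangentLevel {z h : C8} : h ∈ tangentLevel z ↔
    halfDNormSq z h 0 + halfDNormSq z h 4 = 0 ∧
    halfDNormSq z h 1 + halfDNormSq z h 4 + halfDNormSq z h 6 = 0 ∧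
    halfDNormSq z h 2 + halfDNormSq z h 6 = 0 ∧
    halfDNormSq z h 3 - halfDNormSq z h 4 + halfDNormSq z h 6 = 0 ∧
    halfDNormSq z h 4 - halfDNormSq z h 5 + halfDNormSq z h 6 = 0 ∧
    halfDNormSq z h 4 - halfDNormSq z h 6 + halfDNormSq z h 7 = 0 := by
  have : h ∈ tangentLevel z ↔ ∀ k, fderiv ℝ momentL z h k = 0 := by
    simp only [tangentLevel, LinearMap.mem_ker]
    exact funext_iff
  rw [this]
  simp only [fderiv_momentL, neg_eq_zero, Fin.forall_fin_succ, Fin.sum_univ_eight, weight]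
  simp [sub_eq_add_neg]

lemma differentiable_preJ : Differentiable ℝ preJ := by
  have h := (differentiable_normSq_coord 0).const_mul (1 / 2 : ℝ)
  have e : preJ = fun z => 1 / 2 * ‖z 0‖ ^ 2 := by
    funext z
    rw [preJ]
    ring
  rwa [e]

lemma fderiv_preJ (z h : C8) : fderiv ℝ preJ z h = halfDNormSq z h 0 := by
  refine fderiv_apply_of_line (differentiable_preJ z) ?_
  refine ((hasDerivAt_line_normSq z h 0).div_const 2).congr_deriv ?_
  ring

/-- The derivative of `conj (z₂ z₃ z₄) z₆ z₇ z₈` in the direction `h`. -/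
def dMonomial (z h : C8) : ℂ :=
  conj (h 1 * z 2 * z 3 + z 1 * h 2 * z 3 + z 1 * z 2 * h 3) * z 5 * z 6 * z 7 +
    conj (z 1 * z 2 * z 3) * (h 5 * z 6 * z 7 + z 5 * h 6 * z 7 + z 5 * z 6 * h 7)

lemma hasDerivAt_line_monomial (z h : C8) :
    HasDerivAt (fun s : ℝ => (conj ((z + s • h) 1 * (z + s • h) 2 * (z + s • h) 3) *
      (z + s • h) 5 * (z + s • h) 6 * (z + s • h) 7).re) (dMonomial z h).re 0 := by
  have c := hasDerivAt_line_coord z h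
  have h1 : HasDerivAt (fun s : ℝ => conj ((z + s • h) 1 * (z + s • h) 2 * (z + s • h) 3)) _ 0 :=
    Complex.conjCLE.hasFDerivAt.comp_hasDerivAt (0 : ℝ) (((c 1).mul (c 2)).mul (c 3))
  have h2 := ((h1.mul (c 5)).mul (c 6)).mul (c 7)
  have h3 := Complex.reCLM.hasFDerivAt.comp_hasDerivAt (0 : ℝ) h2
  refine h3.congr_deriv ?_
  simp only [dMonomial, Complex.reCLM_apply]
  congr 1
  simp
  ring

lemma differentiable_monomial : Differentiable ℝ (fun z : C8 =>
    (conj (z 1 * z 2 * z 3) * z 5 * z 6 * z 7).re) := by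
  have h1 : Differentiable ℝ (fun z : C8 => conj (z 1 * z 2 * z 3)) :=
    Complex.conjCLE.differentiable.comp
      (by fun_prop : Differentiable ℝ (fun z : C8 => z 1 * z 2 * z 3))
  exact Complex.reCLM.differentiable.comp
    (by fun_prop : Differentiable ℝ (fun z : C8 => conj (z 1 * z 2 * z 3) * z 5 * z 6 * z 7))

/-- Fourth powers become squares of `‖z j‖ ^ 2`, which is differentiable even where `z j = 0`,
unlike the norm itself. -/
lemma preHt_eq (t : Fin 4 → ℝ) : preHt t = fun z : C8 =>
    (1 - 2 * t 0) * (‖z 2‖ ^ 2 / 2) +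
      (t 0 * (1 / 50 * (conj (z 1 * z 2 * z 3) * z 5 * z 6 * z 7).re) +
      t 1 * (1 / 50 * ((‖z 4‖ ^ 2) ^ 2 * (‖z 3‖ ^ 2) ^ 2)) +
      t 2 * (1 / 50 * ((‖z 3‖ ^ 2) ^ 2 * (‖z 6‖ ^ 2) ^ 2)) +
      t 3 * (1 / 100 * ((‖z 4‖ ^ 2) ^ 2 * (‖z 6‖ ^ 2) ^ 2))) := by
  funext z
  simp only [preHt, preH, preGamma, norm_pow_four, Fin.sum_univ_four]
  rfl

lemma differentiable_preHt (t : Fin 4 → ℝ) : Differentiable ℝ (preHt t) := by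
  rw [preHt_eq]
  have h1 := differentiable_normSq_coord
  have h2 := differentiable_monomial
  fun_prop

lemma fderiv_preHt (t : Fin 4 → ℝ) (z h : C8) : fderiv ℝ (preHt t) z h =
    (1 - 2 * t 0) * halfDNormSq z h 2 + t 0 / 50 * (dMonomial z h).re +
    t 1 / 50 * (4 * ‖z 4‖ ^ 2 * halfDNormSq z h 4 * ‖z 3‖ ^ 4 +
      4 * ‖z 4‖ ^ 4 * ‖z 3‖ ^ 2 * halfDNormSq z h 3) +
    t 2 / 50 * (4 * ‖z 3‖ ^ 2 * halfDNormSq z h 3 * ‖z 6‖ ^ 4 +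
      4 * ‖z 3‖ ^ 4 * ‖z 6‖ ^ 2 * halfDNormSq z h 6) +
    t 3 / 100 * (4 * ‖z 4‖ ^ 2 * halfDNormSq z h 4 * ‖z 6‖ ^ 4 +
      4 * ‖z 4‖ ^ 4 * ‖z 6‖ ^ 2 * halfDNormSq z h 6) := by
  refine fderiv_apply_of_line (differentiable_preHt t z) ?_
  rw [preHt_eq]
  have n := hasDerivAt_line_normSq z h
  have p := fun i j => ((n i).fun_pow 2).fun_mul ((n j).fun_pow 2)
  refine ((((n 2).div_const 2).const_mul (1 - 2 * t 0)).add
    ((((((hasDerivAt_line_monomial z h).const_mul (1 / 50)).const_mul (t 0)).add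
      (((p 4 3).const_mul (1 / 50)).const_mul (t 1))).add
      (((p 3 6).const_mul (1 / 50)).const_mul (t 2))).add
      (((p 4 6).const_mul (1 / 100)).const_mul (t 3)))).congr_deriv ?_
  simp
  ring

lemma fderiv_preF (t : Fin 4 → ℝ) (z h : C8) :
    fderiv ℝ (preF t) z h = (halfDNormSq z h 0, fderiv ℝ (preHt t) z h) := by
  have := (differentiable_preJ z).fderiv_prodMk (differentiable_preHt t z)
  change fderiv ℝ (fun z => (preJ z, preHt t z)) z h = _
  rw [this, ContinuousLinearMap.prod_apply, fderiv_preJ]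

/-! ### Rank criteria for `(J, H_t)` on the zero level -/

lemma one_le_levelRank_preF {t : Fin 4 → ℝ} {z h : C8} (hh : h ∈ tangentLevel z)
    (h0 : halfDNormSq z h 0 ≠ 0) : 1 ≤ levelRank (preF t) z := by
  rw [levelRank, Nat.one_le_iff_ne_zero, Ne, Submodule.finrank_eq_zero, Submodule.eq_bot_iff]
  intro hb
  have := hb _ (Submodule.mem_map_of_mem hh)
  rw [ContinuousLinearMap.coe_coe, fderiv_preF] at this
  exact h0 (congrArg Prod.fst this)

lemma levelRank_preF_eq_two {t : Fin 4 → ℝ} {z h k : C8} (hh : h ∈ tangentLevel z)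
    (h0 : halfDNormSq z h 0 ≠ 0) (hk : k ∈ tangentLevel z) (hk0 : halfDNormSq z k 0 = 0)
    (hk1 : fderiv ℝ (preHt t) z k ≠ 0) : levelRank (preF t) z = 2 := by
  have htop : (tangentLevel z).map (fderiv ℝ (preF t) z).toLinearMap = ⊤ := by
    rw [eq_top_iff]
    rintro ⟨a, b⟩ -
    set α := halfDNormSq z h 0
    set β := fderiv ℝ (preHt t) z h with hβ
    set δ := fderiv ℝ (preHt t) z k with hδ
    -- The images of `h` and `k` are `(α, β)` and `(0, δ)` with `α, δ ≠ 0`: a triangular system,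
    -- solved for `(a, b)`.
    refine ⟨(a / α) • h + ((b - a / α * β) / δ) • k,
      Submodule.add_mem _ (Submodule.smul_mem _ _ hh) (Submodule.smul_mem _ _ hk), ?_⟩
    rw [ContinuousLinearMap.coe_coe, map_add, map_smul, map_smul, fderiv_preF, fderiv_preF, hk0,
      ← hβ, ← hδ]
    ext
    · simpa using div_mul_cancel₀ a h0
    · simp [div_mul_cancel₀ _ hk1]
  rw [levelRank, htop, finrank_top]
  simp

lemma levelRank_preF_eq_one {t : Fin 4 → ℝ} {z h : C8} (hh : h ∈ tangentLevel z)
    (h0 : halfDNormSq z h 0 ≠ 0)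
    (hker : ∀ k ∈ tangentLevel z, halfDNormSq z k 0 = 0 → fderiv ℝ (preHt t) z k = 0) :
    levelRank (preF t) z = 1 := by
  refine le_antisymm ?_ (one_le_levelRank_preF hh h0)
  set W := (tangentLevel z).map (fderiv ℝ (preF t) z).toLinearMap
  -- By `hker` a vector of the image is determined by its `J`-component, so projecting to that
  -- component bounds the dimension by one.
  have hinj : Function.Injective ((LinearMap.fst ℝ ℝ ℝ).domRestrict W) := by
    rw [← LinearMap.ker_eq_bot, LinearMap.ker_eq_bot']
    rintro ⟨_, k, hk, rfl⟩ hk0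
    have e : (fderiv ℝ (preF t) z).toLinearMap k =
        (halfDNormSq z k 0, fderiv ℝ (preHt t) z k) := fderiv_preF t z k
    have hk1 : halfDNormSq z k 0 = 0 := by
      have h1 : ((fderiv ℝ (preF t) z).toLinearMap k).1 = 0 := hk0
      rwa [e] at h1
    refine Subtype.ext ?_
    change (fderiv ℝ (preF t) z).toLinearMap k = 0
    rw [e, hk1, hker k hk hk1]
    rfl
  have h1 := LinearMap.finrank_le_finrank_of_injective hinj
  rwa [Module.finrank_self] at h1

/-! ### Tangent vectors in the chart and the condition `v = 0` -/

/-- The radicands at the point of `V1` with coordinates `w`. -/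
abbrev rad (w : ℂ × ℂ) (k : Fin 6) : ℝ := radicand (‖w.1‖ ^ 2) (‖w.2‖ ^ 2) k

/-- A tangent vector of the zero level at `chartRep w`, with prescribed first two coordinates. -/
def chartTangent (w k : ℂ × ℂ) : C8 :=
  let m := w.1.re * k.1.re + w.1.im * k.1.im
  let n := w.2.re * k.2.re + w.2.im * k.2.im
  ![k.1, k.2, ((n - m) / √(rad w 0) : ℝ), ((n - 2 * m) / √(rad w 1) : ℝ),
    (-m / √(rad w 2) : ℝ), (-n / √(rad w 3) : ℝ), ((m - n) / √(rad w 4) : ℝ),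
    ((2 * m - n) / √(rad w 5) : ℝ)]

/-- The vector is the derivative of `chartRep` at `w` in the direction `k`: each square root varies
by half the variation of its radicand, divided by the root. -/
lemma chartTangent_mem {w : ℂ × ℂ} (hw : w ∈ V1) (k : ℂ × ℂ) :
    chartTangent w k ∈ tangentLevel (chartRep w) := by
  have h : ∀ i, √(rad w i) ≠ 0 := fun i => (Real.sqrt_pos.2 (hw i)).ne'
  rw [mem_tangentLevel]
  simp only [halfDNormSq, chartTangent, chartRep]
  refine ⟨?_, ?_, ?_, ?_, ?_, ?_⟩ <;> simp [mul_div_cancel₀ _ (h _)] <;> ring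

lemma halfDNormSq_chartTangent_zero (w k : ℂ × ℂ) :
    halfDNormSq (chartRep w) (chartTangent w k) 0 = w.1.re * k.1.re + w.1.im * k.1.im := rfl

lemma exists_tangent_dJ_ne_zero {w : ℂ × ℂ} (hw : w ∈ V1) (h1 : w.1 ≠ 0) :
    ∃ h ∈ tangentLevel (chartRep w), halfDNormSq (chartRep w) h 0 ≠ 0 := by
  refine ⟨_, chartTangent_mem hw (w.1, 0), ?_⟩
  rw [halfDNormSq_chartTangent_zero, ← Complex.normSq_apply]
  exact (Complex.normSq_pos.2 h1).ne'

lemma fst_ne_zero_of_dJNonzero {w : V1} (h : dJNonzero (phi1 w)) : w.1.1 ≠ 0 := by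
  intro h0
  refine h ?_
  change levelRank preJ (chartRep w.1) = 0
  rw [levelRank, Submodule.finrank_eq_zero, Submodule.eq_bot_iff]
  rintro _ ⟨k, -, rfl⟩
  rw [ContinuousLinearMap.coe_coe, fderiv_preJ]
  simp [halfDNormSq, chartRep, h0]

lemma norm_chartRep_pos {w : ℂ × ℂ} (hw : w ∈ V1) (i : Fin 6) : 0 < √(rad w i) :=
  Real.sqrt_pos.2 (hw i)

lemma levelRank_eq_two_of_im_ne_zero {t : Fin 4 → ℝ} (ht : t 0 ≠ 0) {w : ℂ × ℂ} (hw : w ∈ V1)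
    (h1 : w.1 ≠ 0) (hv : w.2.im ≠ 0) : levelRank (preF t) (chartRep w) = 2 := by
  obtain ⟨h, hh, h0⟩ := exists_tangent_dJ_ne_zero hw h1
  have hp := fun i => (norm_chartRep_pos hw i).ne'
  -- The second vector is the infinitesimal rotation of `z₃`. It preserves every modulus, so only
  -- the `γ₁` term of `H_t` contributes.
  refine levelRank_preF_eq_two hh h0 (k := ![0, 0, Complex.I, 0, 0, 0, 0, 0]) ?_ ?_ ?_
  · rw [mem_tangentLevel]
    simp [halfDNormSq, chartRep]
  · simp [halfDNormSq, chartRep]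
  · rw [fderiv_preHt]
    simp [halfDNormSq, chartRep, dMonomial]
    exact ⟨ht, ⟨⟨⟨hv, hp 1⟩, hp 3⟩, hp 4⟩, hp 5⟩

/-! ### Singular points with real `z₂` -/

/-- `∂_{r₂} Γ_t = r₂ · gammaSlope`. -/
def gammaSlope (t : Fin 4 → ℝ) (r u : ℝ) : ℝ :=
  (1 - 2 * t 0) + t 1 / 50 * (4 * (6 - r ^ 2) ^ 2 * (6 - 2 * r ^ 2 + u ^ 2)) +
    t 2 / 50 * (4 * (6 - 2 * r ^ 2 + u ^ 2) * (4 + r ^ 2 - u ^ 2) ^ 2 -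
      4 * (6 - 2 * r ^ 2 + u ^ 2) ^ 2 * (4 + r ^ 2 - u ^ 2)) -
    t 3 / 100 * (4 * (6 - r ^ 2) ^ 2 * (4 + r ^ 2 - u ^ 2))

/-- The derivative of `fiveProd` with respect to the square of its second variable. -/
def fiveProdSlope (r u : ℝ) : ℝ :=
  -((2 + 2 * r ^ 2 - u ^ 2) * (6 - 2 * r ^ 2 + u ^ 2) * (4 + r ^ 2 - u ^ 2) * (2 - r ^ 2 + u ^ 2)) -
  (8 - u ^ 2) * (6 - 2 * r ^ 2 + u ^ 2) * (4 + r ^ 2 - u ^ 2) * (2 - r ^ 2 + u ^ 2) +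
  (8 - u ^ 2) * (2 + 2 * r ^ 2 - u ^ 2) * (4 + r ^ 2 - u ^ 2) * (2 - r ^ 2 + u ^ 2) -
  (8 - u ^ 2) * (2 + 2 * r ^ 2 - u ^ 2) * (6 - 2 * r ^ 2 + u ^ 2) * (2 - r ^ 2 + u ^ 2) +
  (8 - u ^ 2) * (2 + 2 * r ^ 2 - u ^ 2) * (6 - 2 * r ^ 2 + u ^ 2) * (4 + r ^ 2 - u ^ 2)

/-- `√S` times the derivative of `H_t` in the direction of `u` at `z₂ = u`, with `J` constant. -/
def critFun (t : Fin 4 → ℝ) (r u : ℝ) : ℝ :=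
  √(fiveProd r u) * u * gammaSlope t r u +
    t 0 / 50 * (fiveProd r u + u ^ 2 * fiveProdSlope r u)

lemma sqrt_fiveProd {w : ℂ × ℂ} (hw : w ∈ V1) : √(fiveProd ‖w.1‖ ‖w.2‖) =
    √(rad w 0) * √(rad w 1) * √(rad w 3) * √(rad w 4) * √(rad w 5) := by
  have h := fun i => (hw i).le
  have h0 := h 0
  have h1 := h 1
  have h3 := h 3
  have h4 := h 4
  rw [← Real.sqrt_mul h0, ← Real.sqrt_mul (mul_nonneg h0 h1),
    ← Real.sqrt_mul (mul_nonneg (mul_nonneg h0 h1) h3),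
    ← Real.sqrt_mul (mul_nonneg (mul_nonneg (mul_nonneg h0 h1) h3) h4)]
  congr 1
  simp [fiveProd, rad, radicand]
  ring

lemma fiveProd_pos {w : ℂ × ℂ} (hw : w ∈ V1) : 0 < fiveProd ‖w.1‖ ‖w.2‖ := by
  have h := norm_chartRep_pos hw
  rw [← Real.sqrt_pos, sqrt_fiveProd hw]
  exact mul_pos (mul_pos (mul_pos (mul_pos (h 0) (h 1)) (h 3)) (h 4)) (h 5)

lemma norm_sq_of_im_eq_zero {c : ℂ} (h : c.im = 0) : ‖c‖ ^ 2 = c.re ^ 2 := by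
  rw [← Complex.normSq_eq_norm_sq, Complex.normSq_apply, h]; ring

/-- On `ker d𝓛 ∩ ker dJ` a single parameter `n = u · Re k₂` governs all variations of moduli. As
every factor of the monomial in `γ₁` is real at this point, imaginary parts of `k` do not enter. The
factor `√S = x₃x₄x₆x₇x₈` removes all denominators. -/
lemma sqrt_fiveProd_mul_fderiv_preHt {t : Fin 4 → ℝ} {w : ℂ × ℂ} (hw : w ∈ V1)
    (hv : w.2.im = 0) {k : C8} (hk : k ∈ tangentLevel (chartRep w))
    (hk0 : halfDNormSq (chartRep w) k 0 = 0) :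
    √(fiveProd ‖w.1‖ ‖w.2‖) * fderiv ℝ (preHt t) (chartRep w) k =
      (k 1).re * critFun t ‖w.1‖ w.2.re := by
  have hn2 := norm_sq_of_im_eq_zero hv
  have hS : fiveProd ‖w.1‖ w.2.re = fiveProd ‖w.1‖ ‖w.2‖ := by simp only [fiveProd, hn2]
  rw [mem_tangentLevel, hk0] at hk
  obtain ⟨e0, e1, e2, e3, e4, e5⟩ := hk
  set n := halfDNormSq (chartRep w) k 1 with hn
  have n5 : halfDNormSq (chartRep w) k 4 = 0 := by linarith
  have n7 : halfDNormSq (chartRep w) k 6 = -n := by linarith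
  have n3 : halfDNormSq (chartRep w) k 2 = n := by linarith
  have n4 : halfDNormSq (chartRep w) k 3 = n := by linarith
  have n6 : halfDNormSq (chartRep w) k 5 = -n := by linarith
  have n8 : halfDNormSq (chartRep w) k 7 = -n := by linarith
  have hnu : n = w.2.re * (k 1).re := by simp [hn, halfDNormSq, chartRep, hv]
  have q := fun i => Real.sq_sqrt (hw i).le
  have q0 : √(rad w 0) ^ 2 = 2 - ‖w.1‖ ^ 2 + w.2.re ^ 2 := by rw [← hn2]; exact q 0
  have q1 : √(rad w 1) ^ 2 = 6 - 2 * ‖w.1‖ ^ 2 + w.2.re ^ 2 := by rw [← hn2]; exact q 1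
  have q2 : √(rad w 2) ^ 2 = 6 - ‖w.1‖ ^ 2 := q 2
  have q3 : √(rad w 3) ^ 2 = 8 - w.2.re ^ 2 := by rw [← hn2]; exact q 3
  have q4 : √(rad w 4) ^ 2 = 4 + ‖w.1‖ ^ 2 - w.2.re ^ 2 := by rw [← hn2]; exact q 4
  have q5 : √(rad w 5) ^ 2 = 2 + 2 * ‖w.1‖ ^ 2 - w.2.re ^ 2 := by rw [← hn2]; exact q 5
  have hD : √(fiveProd ‖w.1‖ ‖w.2‖) * (dMonomial (chartRep w) k).re =
      (k 1).re * (fiveProd ‖w.1‖ w.2.re + w.2.re ^ 2 * fiveProdSlope ‖w.1‖ w.2.re) := by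
    rw [sqrt_fiveProd hw]
    simp only [halfDNormSq, chartRep] at n3 n4 n6 n7 n8
    simp at n3 n4 n6 n7 n8
    simp [dMonomial, chartRep, hv]
    rw [hnu] at n3 n4 n6 n7 n8
    simp only [fiveProd, fiveProdSlope, ← q0, ← q1, ← q3, ← q4, ← q5]
    generalize √(rad w 0) = x3 at *
    generalize √(rad w 1) = x4 at *
    generalize √(rad w 3) = x6 at *
    generalize √(rad w 4) = x7 at *
    generalize √(rad w 5) = x8 at *
    -- Multiplication by `√S` turns the term containing `Re k_j` into `u (√S / x_j)²` times `x_j Re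
    -- k_j`, and the latter is `±u Re k₂`.
    linear_combination w.2.re * (x4 * x6 * x7 * x8) ^ 2 * n3 +
      w.2.re * (x3 * x6 * x7 * x8) ^ 2 * n4 + w.2.re * (x3 * x4 * x7 * x8) ^ 2 * n6 +
      w.2.re * (x3 * x4 * x6 * x8) ^ 2 * n7 + w.2.re * (x3 * x4 * x6 * x7) ^ 2 * n8
  have m3 : ‖chartRep w 3‖ ^ 2 = 6 - 2 * ‖w.1‖ ^ 2 + w.2.re ^ 2 := by
    rw [← q1]; simp [chartRep]
  have m4 : ‖chartRep w 4‖ ^ 2 = 6 - ‖w.1‖ ^ 2 := by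
    rw [← q2]; simp [chartRep]
  have m6 : ‖chartRep w 6‖ ^ 2 = 4 + ‖w.1‖ ^ 2 - w.2.re ^ 2 := by
    rw [← q4]; simp [chartRep]
  rw [fderiv_preHt, n3, n4, n5, n7]
  simp only [norm_pow_four, m3, m4, m6]
  rw [hS] at hD
  rw [critFun, hS]
  simp only [gammaSlope, hnu]
  linear_combination t 0 / 50 * hD

lemma levelRank_chartRep_eq_one_iff {t : Fin 4 → ℝ} {w : ℂ × ℂ} (hw : w ∈ V1)
    (h1 : w.1 ≠ 0) (hv : w.2.im = 0) :
    levelRank (preF t) (chartRep w) = 1 ↔ critFun t ‖w.1‖ w.2.re = 0 := by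
  obtain ⟨h, hh, h0⟩ := exists_tangent_dJ_ne_zero hw h1
  have hP := (Real.sqrt_pos.2 (fiveProd_pos hw)).ne'
  constructor
  · intro hr
    by_contra hc
    -- The direction of `u` has `Re k₂ = 1`, so a nonzero `critFun` gives `dH_t ≠ 0` along it.
    have hk := chartTangent_mem hw (0, 1)
    have hk0 : halfDNormSq (chartRep w) (chartTangent w (0, 1)) 0 = 0 := by
      simp [halfDNormSq_chartTangent_zero]
    have e := sqrt_fiveProd_mul_fderiv_preHt (t := t) hw hv hk hk0
    have := levelRank_preF_eq_two (t := t) hh h0 hk hk0 (fun h' => by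
      rw [h'] at e
      simp [chartTangent] at e
      exact hc e.symm)
    omega
  · intro hc
    refine levelRank_preF_eq_one hh h0 fun k hk hk0 => ?_
    have e := sqrt_fiveProd_mul_fderiv_preHt (t := t) hw hv hk hk0
    rw [hc, mul_zero] at e
    exact (mul_eq_zero.1 e).resolve_left hP

lemma im_eq_zero_and_critFun_of_isSingular {t : Fin 4 → ℝ} (ht : t 0 ≠ 0) {w : V1}
    (hs : IsSingular t (phi1 w)) (h1 : w.1.1 ≠ 0) :
    w.1.2.im = 0 ∧ IsRankOneSingular t (phi1 w) ∧ critFun t ‖w.1.1‖ w.1.2.re = 0 := by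
  change levelRank (preF t) (chartRep w.1) < 2 at hs
  have hv : w.1.2.im = 0 := by
    by_contra hv
    have := levelRank_eq_two_of_im_ne_zero ht w.2 h1 hv
    omega
  obtain ⟨h, hh, h0⟩ := exists_tangent_dJ_ne_zero w.2 h1
  have hone := one_le_levelRank_preF (t := t) hh h0
  have hr : levelRank (preF t) (chartRep w.1) = 1 := by omega
  exact ⟨hv, hr, (levelRank_chartRep_eq_one_iff w.2 h1 hv).1 hr⟩

/-! ### Derivatives of `Γ_t` and `Ω̄` in `r₂` and the equation for singular points -/

lemma hasDerivAt_fiveProd (r s : ℝ) :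
    HasDerivAt (fun s => fiveProd r s) (2 * s * fiveProdSlope r s) s := by
  have q : HasDerivAt (fun s : ℝ => s ^ 2) (2 * s) s := by simpa using hasDerivAt_pow 2 s
  have h := ((((q.const_sub 8).fun_mul (q.const_sub (2 + 2 * r ^ 2))).fun_mul
    (q.const_add (6 - 2 * r ^ 2))).fun_mul (q.const_sub (4 + r ^ 2))).fun_mul
    (q.const_add (2 - r ^ 2))
  refine h.congr_deriv ?_
  simp only [fiveProdSlope]
  ring

lemma dGammaT_eq (t : Fin 4 → ℝ) (r s : ℝ) : dGammaT t r s = s * gammaSlope t r s := by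
  have q : HasDerivAt (fun s : ℝ => s ^ 2) (2 * s) s := by simpa using hasDerivAt_pow 2 s
  have q1 := (q.const_add (6 - 2 * r ^ 2)).fun_pow 2
  have q2 := (q.const_sub (4 + r ^ 2)).fun_pow 2
  have h := ((((((q.const_add (2 - r ^ 2)).div_const 2).const_mul (1 - 2 * t 0)).add
    ((q1.const_mul ((6 - r ^ 2) ^ 2)).const_mul (t 1 / 50))).add
    ((q1.fun_mul q2).const_mul (t 2 / 50))).add
    ((q2.const_mul ((6 - r ^ 2) ^ 2)).const_mul (t 3 / 100)))
  refine (HasDerivAt.deriv h).trans ?_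
  simp only [gammaSlope]
  push_cast
  ring

lemma sqrt_mul_dOmegaBar {r s : ℝ} (h : 0 < fiveProd r s) :
    √(fiveProd r s) * dOmegaBar r s =
      1 / 50 * (fiveProd r s + s ^ 2 * fiveProdSlope r s) := by
  have h1 := ((hasDerivAt_id s).div_const 50).fun_mul ((hasDerivAt_fiveProd r s).sqrt h.ne')
  have h2 : dOmegaBar r s = _ := HasDerivAt.deriv h1
  have h3 := Real.sq_sqrt h.le
  have h4 := (Real.sqrt_pos.2 h).ne'
  rw [h2]
  simp only [id]
  field_simp
  linear_combination h3

/-- `S`, its slope and `gammaSlope` are even in the second variable. Hence the sign `ε` affects only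
the explicit factor `u` in `critFun`, and `ε ^ 2 = 1` moves it to the other term. -/
lemma sqrt_mul_dGammaT_add {r s : ℝ} (h : 0 < fiveProd r s) (t : Fin 4 → ℝ) {ε : ℝ}
    (hε : ε ^ 2 = 1) :
    √(fiveProd r s) * (dGammaT t r s + t 0 * ε * dOmegaBar r s) = ε * critFun t r (ε * s) := by
  have e : (ε * s) ^ 2 = s ^ 2 := by rw [mul_pow, hε, one_mul]
  have e1 : fiveProd r (ε * s) = fiveProd r s := by simp only [fiveProd, e]
  have e2 : fiveProdSlope r (ε * s) = fiveProdSlope r s := by simp only [fiveProdSlope, e]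
  have e3 : gammaSlope t r (ε * s) = gammaSlope t r s := by simp only [gammaSlope, e]
  rw [critFun, e, e1, e2, e3, dGammaT_eq]
  linear_combination t 0 * ε * sqrt_mul_dOmegaBar h -
    √(fiveProd r s) * s * gammaSlope t r s * hε

lemma critFun_eq_zero_iff {r s : ℝ} (h : 0 < fiveProd r s) (t : Fin 4 → ℝ) {ε : ℝ}
    (hε : ε ^ 2 = 1) :
    critFun t r (ε * s) = 0 ↔ dGammaT t r s + t 0 * ε * dOmegaBar r s = 0 := by
  have e := sqrt_mul_dGammaT_add h t hε
  have h4 := (Real.sqrt_pos.2 h).ne'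
  have h5 : ε ≠ 0 := by rintro rfl; norm_num at hε
  rw [← mul_eq_zero_iff_left h5, ← e, mul_eq_zero, or_iff_right h4]

lemma exists_sign_mul_abs (u : ℝ) : ∃ ε : ℝ, ε ^ 2 = 1 ∧ u = ε * |u| := by
  rcases abs_cases u with ⟨h, -⟩ | ⟨h, -⟩
  · exact ⟨1, by norm_num, by rw [h, one_mul]⟩
  · exact ⟨-1, by norm_num, by rw [h]; ring⟩

lemma norm_eq_abs_re {c : ℂ} (h : c.im = 0) : ‖c‖ = |c.re| := by
  rw [← abs_of_nonneg (norm_nonneg c), ← sq_eq_sq_iff_abs_eq_abs]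
  exact norm_sq_of_im_eq_zero h

lemma singExpr_eq_zero_of_critFun {t : Fin 4 → ℝ} {w : ℂ × ℂ} (hw : w ∈ V1) (hv : w.2.im = 0)
    (hc : critFun t ‖w.1‖ w.2.re = 0) : singExpr t ‖w.1‖ ‖w.2‖ = 0 := by
  obtain ⟨ε, hε, hu⟩ := exists_sign_mul_abs w.2.re
  rw [← norm_eq_abs_re hv] at hu
  rw [hu, critFun_eq_zero_iff (fiveProd_pos hw) t hε] at hc
  rw [singExpr]
  -- Multiplying by the factor with the opposite sign gives the difference of squares, up to `ε ^ 2
  -- = 1`.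
  linear_combination (dGammaT t ‖w.1‖ ‖w.2‖ - t 0 * ε * dOmegaBar ‖w.1‖ ‖w.2‖) * hc +
    t 0 ^ 2 * dOmegaBar ‖w.1‖ ‖w.2‖ ^ 2 * hε

/-! ### Polar coordinates -/

lemma polar1_snd (r : ℝ × ℝ) (ϑ₁ ϑ₂ : ℝ) :
    (polar1 r ϑ₁ ϑ₂).2.re = r.2 * Real.cos ϑ₂ ∧ (polar1 r ϑ₁ ϑ₂).2.im = r.2 * Real.sin ϑ₂ := by
  simp [polar1, -Complex.ofReal_cos, -Complex.ofReal_sin]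

lemma D1_nonneg {r : ℝ × ℝ} (hr : r ∈ D1) : 0 ≤ r.1 ∧ 0 ≤ r.2 := by
  obtain ⟨w, -, rfl⟩ := hr
  exact ⟨norm_nonneg _, norm_nonneg _⟩

lemma D1_fiveProd_pos {r : ℝ × ℝ} (hr : r ∈ D1) : 0 < fiveProd r.1 r.2 := by
  obtain ⟨w, hw, rfl⟩ := hr
  exact fiveProd_pos hw

lemma norm_polar1 {r : ℝ × ℝ} (hr : r ∈ D1) (ϑ₁ ϑ₂ : ℝ) :
    ‖(polar1 r ϑ₁ ϑ₂).1‖ = r.1 ∧ ‖(polar1 r ϑ₁ ϑ₂).2‖ = r.2 := by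
  have h := D1_nonneg hr
  exact ⟨(sq_eq_sq₀ (norm_nonneg _) h.1).1 (norm_polar_aux r.1 ϑ₁),
    (sq_eq_sq₀ (norm_nonneg _) h.2).1 (norm_polar_aux r.2 ϑ₂)⟩

lemma phiPolar_isRankOneSingular_iff {t : Fin 4 → ℝ} (r : D1) (hr : r.1.1 ≠ 0) (ϑ₁ : ℝ) {ϑ₂ : ℝ}
    (h2 : ϑ₂ = 0 ∨ ϑ₂ = Real.pi) : IsRankOneSingular t (phiPolar r ϑ₁ ϑ₂) ↔
      dGammaT t r.1.1 r.1.2 + t 0 * Real.cos ϑ₂ * dOmegaBar r.1.1 r.1.2 = 0 := by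
  obtain ⟨n1, n2⟩ := norm_polar1 r.2 ϑ₁ ϑ₂
  obtain ⟨p1, p2⟩ := polar1_snd r.1 ϑ₁ ϑ₂
  have hsin : Real.sin ϑ₂ = 0 := by rcases h2 with rfl | rfl <;> simp
  have hcos : Real.cos ϑ₂ ^ 2 = 1 := by rcases h2 with rfl | rfl <;> simp
  have h1 : (polar1 r.1 ϑ₁ ϑ₂).1 ≠ 0 := by rwa [← norm_ne_zero_iff, n1]
  refine (levelRank_chartRep_eq_one_iff (polar1_mem r.2 ϑ₁ ϑ₂) h1
    (by rw [p2, hsin, mul_zero])).trans ?_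
  rw [n1, p1, mul_comm r.1.2]
  exact critFun_eq_zero_iff (D1_fiveProd_pos r.2) t hcos

lemma add_mul_cos_eq_zero_or_of_sq {t x y : ℝ} (h : x ^ 2 - t ^ 2 * y ^ 2 = 0) :
    x + t * Real.cos 0 * y = 0 ∨ x + t * Real.cos Real.pi * y = 0 := by
  rw [← mul_eq_zero, Real.cos_zero, Real.cos_pi]
  linear_combination h

lemma critFun_zero_ne_zero {t : Fin 4 → ℝ} (ht : t 0 ≠ 0) {r : ℝ} (h : 0 < fiveProd r 0) :
    critFun t r 0 ≠ 0 := by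
  simp [critFun, ht, h.ne']

lemma chartRep_J (w : ℂ × ℂ) : preJ (chartRep w) = ‖w.1‖ ^ 2 / 2 := rfl

lemma chartRep_gamma_zero {w : ℂ × ℂ} (hw : w ∈ V1) :
    preGamma (chartRep w) 0 = w.2.re / 50 * √(fiveProd ‖w.1‖ ‖w.2‖) := by
  rw [sqrt_fiveProd hw]
  simp [preGamma, chartRep, rad]
  ring

lemma chartRep_Ht {w : ℂ × ℂ} (hw : w ∈ V1) (t : Fin 4 → ℝ) :
    preHt t (chartRep w) = GammaT t ‖w.1‖ ‖w.2‖ +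
      t 0 * (w.2.re / 50 * √(fiveProd ‖w.1‖ ‖w.2‖)) := by
  have q := fun i => Real.sq_sqrt (hw i).le
  have m2 : ‖chartRep w 2‖ ^ 2 = 2 - ‖w.1‖ ^ 2 + ‖w.2‖ ^ 2 := by
    rw [← show _ = 2 - ‖w.1‖ ^ 2 + ‖w.2‖ ^ 2 from q 0]; simp [chartRep]
  have m3 : ‖chartRep w 3‖ ^ 2 = 6 - 2 * ‖w.1‖ ^ 2 + ‖w.2‖ ^ 2 := by
    rw [← show _ = 6 - 2 * ‖w.1‖ ^ 2 + ‖w.2‖ ^ 2 from q 1]; simp [chartRep]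
  have m4 : ‖chartRep w 4‖ ^ 2 = 6 - ‖w.1‖ ^ 2 := by
    rw [← show _ = 6 - ‖w.1‖ ^ 2 from q 2]; simp [chartRep]
  have m6 : ‖chartRep w 6‖ ^ 2 = 4 + ‖w.1‖ ^ 2 - ‖w.2‖ ^ 2 := by
    rw [← show _ = 4 + ‖w.1‖ ^ 2 - ‖w.2‖ ^ 2 from q 4]; simp [chartRep]
  have e : preHt t (chartRep w) = (1 - 2 * t 0) * (‖chartRep w 2‖ ^ 2 / 2) +
      (t 0 * preGamma (chartRep w) 0 +
      t 1 * (1 / 50 * ((‖chartRep w 4‖ ^ 2) ^ 2 * (‖chartRep w 3‖ ^ 2) ^ 2)) +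
      t 2 * (1 / 50 * ((‖chartRep w 3‖ ^ 2) ^ 2 * (‖chartRep w 6‖ ^ 2) ^ 2)) +
      t 3 * (1 / 100 * ((‖chartRep w 4‖ ^ 2) ^ 2 * (‖chartRep w 6‖ ^ 2) ^ 2))) := by
    rw [preHt_eq]; rfl
  rw [e, m2, m3, m4, m6, chartRep_gamma_zero hw, GammaT]
  ring

lemma phiPolar_values (t : Fin 4 → ℝ) (r : D1) (ϑ₁ ϑ₂ : ℝ) :
    JM (phiPolar r ϑ₁ ϑ₂) = r.1.1 ^ 2 / 2 ∧
    gammaM (phiPolar r ϑ₁ ϑ₂) 0 = Real.cos ϑ₂ * OmegaBar r.1.1 r.1.2 ∧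
    HtM t (phiPolar r ϑ₁ ϑ₂) =
      GammaT t r.1.1 r.1.2 + t 0 * Real.cos ϑ₂ * OmegaBar r.1.1 r.1.2 := by
  obtain ⟨n1, n2⟩ := norm_polar1 r.2 ϑ₁ ϑ₂
  obtain ⟨p1, p2⟩ := polar1_snd r.1 ϑ₁ ϑ₂
  have hw := polar1_mem r.2 ϑ₁ ϑ₂
  refine ⟨?_, ?_, ?_⟩
  · change preJ (chartRep (polar1 r.1 ϑ₁ ϑ₂)) = _
    rw [chartRep_J, n1]
  · change preGamma (chartRep (polar1 r.1 ϑ₁ ϑ₂)) 0 = _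
    rw [chartRep_gamma_zero hw, n1, n2, p1, OmegaBar]
    ring
  · change preHt t (chartRep (polar1 r.1 ϑ₁ ϑ₂)) = _
    rw [chartRep_Ht hw, n1, n2, p1, OmegaBar]
    ring

/-! ### The chart covers `U₁` -/

lemma exists_circle_mul_eq_norm {c : ℂ} (h : c ≠ 0) : ∃ p : Circle, (p : ℂ) * c = (‖c‖ : ℝ) := by
  have hn : (‖c‖ : ℂ) ≠ 0 := by exact_mod_cast norm_ne_zero_iff.2 h
  have hp : ‖(‖c‖ : ℂ) / c‖ = 1 := by
    rw [norm_div, Complex.norm_real, norm_norm, div_self (norm_ne_zero_iff.2 h)]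
  exact ⟨⟨(‖c‖ : ℂ) / c, mem_sphere_zero_iff_norm.2 hp⟩, div_mul_cancel₀ _ h⟩

/-- The weights of `z₃, …, z₈` form a unimodular matrix, so their phases can be prescribed. -/
lemma exists_torus_of_phases (p : Fin 8 → Circle) :
    ∃ θ : Fin 6 → Circle, ∀ j : Fin 8, 2 ≤ j → ∏ k, θ k ^ weight k j = p j := by
  -- Each of `z₃, z₄, z₆, z₈` is moved by one torus factor only (inverted for `z₆`), which fixes `θ
  -- 2`, …, `θ 5`. The phase of `z₇` then forces `θ 1 = c`, and that of `z₅` gives `θ 0`.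
  set c : Circle := p 6 * (p 2)⁻¹ * (p 3)⁻¹ * p 5 * p 7 with hc
  refine ⟨![p 4 * c⁻¹ * p 3 * p 5 * (p 7)⁻¹, c, p 2, p 3, (p 5)⁻¹, p 7], fun j hj => ?_⟩
  have hj' : j = 2 ∨ j = 3 ∨ j = 4 ∨ j = 5 ∨ j = 6 ∨ j = 7 := by revert j; decide
  rcases hj' with rfl | rfl | rfl | rfl | rfl | rfl <;>
    simp [Fin.prod_univ_six, weight]
  · generalize p 4 = x, c = y, p 3 = z, p 5 = a, p 7 = b
    rw [show x * y⁻¹ * z * a * b⁻¹ * y * z⁻¹ * a⁻¹ * b = x * (y * y⁻¹) * (z * z⁻¹) * (a * a⁻¹) *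
      (b * b⁻¹) by ac_rfl]
    simp
  · rw [hc]
    generalize p 6 = x, p 2 = y, p 3 = z, p 5 = a, p 7 = b
    rw [show x * y⁻¹ * z⁻¹ * a * b * y * z * a⁻¹ * b⁻¹ = x * (y * y⁻¹) * (z * z⁻¹) * (a * a⁻¹) *
      (b * b⁻¹) by ac_rfl]
    simp

lemma normSq_eq_radicand {z : C8} (h : momentL z = 0) :
    ‖z 2‖ ^ 2 = radicand (‖z 0‖ ^ 2) (‖z 1‖ ^ 2) 0 ∧
    ‖z 3‖ ^ 2 = radicand (‖z 0‖ ^ 2) (‖z 1‖ ^ 2) 1 ∧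
    ‖z 4‖ ^ 2 = radicand (‖z 0‖ ^ 2) (‖z 1‖ ^ 2) 2 ∧
    ‖z 5‖ ^ 2 = radicand (‖z 0‖ ^ 2) (‖z 1‖ ^ 2) 3 ∧
    ‖z 6‖ ^ 2 = radicand (‖z 0‖ ^ 2) (‖z 1‖ ^ 2) 4 ∧
    ‖z 7‖ ^ 2 = radicand (‖z 0‖ ^ 2) (‖z 1‖ ^ 2) 5 := by
  have h0 := congrFun h 0
  have h1 := congrFun h 1
  have h2 := congrFun h 2
  have h3 := congrFun h 3
  have h4 := congrFun h 4
  have h5 := congrFun h 5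
  simp [momentL, weight, level, Fin.sum_univ_eight] at h0 h1 h2 h3 h4 h5
  simp [radicand]
  refine ⟨?_, ?_, ?_, ?_, ?_, ?_⟩ <;> linarith

lemma range_phi1 : Set.range phi1 = U1 := by
  apply Set.Subset.antisymm
  · rintro _ ⟨w, rfl⟩
    refine ⟨⟨chartRep w.1, momentL_chartRep w.2⟩, rfl, fun j hj => ?_⟩
    have hj' : j = 2 ∨ j = 3 ∨ j = 4 ∨ j = 5 ∨ j = 6 ∨ j = 7 := by revert j; decide
    have hp := fun i => (norm_chartRep_pos w.2 i).ne'
    rcases hj' with rfl | rfl | rfl | rfl | rfl | rfl <;>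
      exact Complex.ofReal_ne_zero.2 (hp _)
  · rintro _ ⟨⟨z, hz⟩, rfl, hne⟩
    -- The phases make `z₃, …, z₈` positive; `z₁` and `z₂` may vanish and need no normalisation, so
    -- `1` is a dummy value there.
    have hP : ∀ j : Fin 8, ∃ p : Circle, 2 ≤ j → (p : ℂ) * z j = (‖z j‖ : ℝ) := fun j => by
      by_cases hj : 2 ≤ j
      · obtain ⟨p, hp⟩ := exists_circle_mul_eq_norm (hne j hj)
        exact ⟨p, fun _ => hp⟩
      · exact ⟨1, fun h => absurd h hj⟩
    choose p hp using hP
    obtain ⟨θ, hθ⟩ := exists_torus_of_phases p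
    obtain ⟨q2, q3, q4, q5, q6, q7⟩ := normSq_eq_radicand hz
    have hpos : ∀ j : Fin 8, 2 ≤ j → 0 < ‖z j‖ ^ 2 := fun j hj =>
      pow_pos (norm_pos_iff.2 (hne j hj)) 2
    have hval : ∀ j : Fin 8, 2 ≤ j → torusAct θ z j = (√(‖z j‖ ^ 2) : ℝ) := fun j hj => by
      rw [torusAct, hθ j hj, hp j hj, Real.sqrt_sq (norm_nonneg _)]
    have hw : (torusAct θ z 0, torusAct θ z 1) ∈ V1 := by
      intro k
      simp only [norm_torusAct]
      fin_cases k
      · exact q2 ▸ hpos 2 (by decide)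
      · exact q3 ▸ hpos 3 (by decide)
      · exact q4 ▸ hpos 4 (by decide)
      · exact q5 ▸ hpos 5 (by decide)
      · exact q6 ▸ hpos 6 (by decide)
      · exact q7 ▸ hpos 7 (by decide)
    refine ⟨⟨_, hw⟩, ?_⟩
    refine (Quotient.sound (s := orbitSetoid) ⟨θ, ?_⟩).symm
    change torusAct θ z = chartRep (torusAct θ z 0, torusAct θ z 1)
    simp only [chartRep, norm_torusAct, ← q2, ← q3, ← q4, ← q5, ← q6, ← q7]
    funext j
    fin_cases j
    · rfl
    · rfl
    all_goals exact hval _ (by decide)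

/-! ### Clearing denominators to a polynomial equation -/

/-- `S` times the left-hand side of the equation for singular points, with `S`, `∂Γ_t` and the
derivative of `S` replaced by polynomials. -/
lemma fiveProd_mul_singExpr {r s : ℝ} (h : 0 < fiveProd r s) (t : Fin 4 → ℝ) :
    fiveProd r s * singExpr t r s = fiveProd r s * (s * gammaSlope t r s) ^ 2 -
      t 0 ^ 2 / 2500 * (fiveProd r s + s ^ 2 * fiveProdSlope r s) ^ 2 := by
  have h1 := sqrt_mul_dOmegaBar h
  have h2 := Real.sq_sqrt h.le
  have h3 : fiveProd r s * dOmegaBar r s ^ 2 =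
      (1 / 50 * (fiveProd r s + s ^ 2 * fiveProdSlope r s)) ^ 2 := by
    rw [← h1, mul_pow, h2]
  rw [singExpr, dGammaT_eq]
  linear_combination -t 0 ^ 2 * h3

/-- Real functions of two variables that are given by a polynomial. -/
def IsPolyFun (f : ℝ → ℝ → ℝ) : Prop :=
  ∃ Q : MvPolynomial (Fin 2) ℝ, ∀ r s, MvPolynomial.eval ![r, s] Q = f r s

namespace IsPolyFun

variable {f g : ℝ → ℝ → ℝ}

lemma const (c : ℝ) : IsPolyFun fun _ _ => c := ⟨MvPolynomial.C c, by simp⟩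

lemma fst : IsPolyFun fun r _ => r := ⟨MvPolynomial.X 0, by simp⟩

lemma snd : IsPolyFun fun _ s => s := ⟨MvPolynomial.X 1, by simp⟩

lemma add (hf : IsPolyFun f) (hg : IsPolyFun g) : IsPolyFun fun r s => f r s + g r s := by
  obtain ⟨P, hP⟩ := hf
  obtain ⟨Q, hQ⟩ := hg
  exact ⟨P + Q, by simp [hP, hQ]⟩

lemma mul (hf : IsPolyFun f) (hg : IsPolyFun g) : IsPolyFun fun r s => f r s * g r s := by
  obtain ⟨P, hP⟩ := hf
  obtain ⟨Q, hQ⟩ := hg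
  exact ⟨P * Q, by simp [hP, hQ]⟩

lemma neg (hf : IsPolyFun f) : IsPolyFun fun r s => -f r s := by
  obtain ⟨P, hP⟩ := hf
  exact ⟨-P, by simp [hP]⟩

lemma sub (hf : IsPolyFun f) (hg : IsPolyFun g) : IsPolyFun fun r s => f r s - g r s := by
  obtain ⟨P, hP⟩ := hf
  obtain ⟨Q, hQ⟩ := hg
  exact ⟨P - Q, by simp [hP, hQ]⟩

lemma pow (hf : IsPolyFun f) (n : ℕ) : IsPolyFun fun r s => f r s ^ n := by
  obtain ⟨P, hP⟩ := hf
  exact ⟨P ^ n, by simp [hP]⟩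

end IsPolyFun

lemma isPolyFun_fiveProd : IsPolyFun fiveProd := by
  unfold fiveProd
  repeat' first
    | exact .const _ | exact .fst | exact .snd | apply IsPolyFun.add
    | apply IsPolyFun.mul | apply IsPolyFun.pow | apply IsPolyFun.neg

lemma isPolyFun_fiveProdSlope : IsPolyFun fiveProdSlope := by
  unfold fiveProdSlope
  repeat' first
    | exact .const _ | exact .fst | exact .snd | apply IsPolyFun.add
    | apply IsPolyFun.mul | apply IsPolyFun.pow | apply IsPolyFun.neg

lemma isPolyFun_gammaSlope (t : Fin 4 → ℝ) : IsPolyFun (gammaSlope t) := by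
  unfold gammaSlope
  repeat' first
    | exact .const _ | exact .fst | exact .snd | apply IsPolyFun.add
    | apply IsPolyFun.mul | apply IsPolyFun.pow | apply IsPolyFun.neg

lemma exists_poly_fiveProd_mul_singExpr {t : Fin 4 → ℝ} (ht : t 0 ≠ 0) :
    ∃ Q : MvPolynomial (Fin 2) ℝ, Q ≠ 0 ∧ ∀ r : D1, 0 < fiveProd r.1.1 r.1.2 ∧
      fiveProd r.1.1 r.1.2 * singExpr t r.1.1 r.1.2 = MvPolynomial.eval ![r.1.1, r.1.2] Q := by
  obtain ⟨Q, hQ⟩ := (isPolyFun_fiveProd.mul ((IsPolyFun.snd.mul (isPolyFun_gammaSlope t)).pow 2)).sub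
    ((IsPolyFun.const (t 0 ^ 2 / 2500)).mul ((isPolyFun_fiveProd.add
      ((IsPolyFun.snd.pow 2).mul isPolyFun_fiveProdSlope)).pow 2))
  refine ⟨Q, ?_, fun r => ⟨D1_fiveProd_pos r.2, ?_⟩⟩
  · rintro rfl
    -- At the origin only the term `-t₁² S² / 2500` survives, and `S(0, 0) ≠ 0`.
    have h := hQ 0 0
    simp [fiveProd, ht] at h
  · rw [fiveProd_mul_singExpr (D1_fiveProd_pos r.2), hQ]

end Octagon

end

theorem mainTheorem6 (t : Fin 4 → ℝ) (ht : t 0 ≠ 0) :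
    -- `φ₁` parametrises `U₁`, and `Γ_t`, `Ω̄` are the functions determined by `H_t` and `γ₁`
    Set.range phi1 = U1 ∧
    (∀ (r : D1) (ϑ₁ ϑ₂ : ℝ),
      JM (phiPolar r ϑ₁ ϑ₂) = r.1.1 ^ 2 / 2 ∧
      gammaM (phiPolar r ϑ₁ ϑ₂) 0 = Real.cos ϑ₂ * OmegaBar r.1.1 r.1.2 ∧
      HtM t (phiPolar r ϑ₁ ϑ₂) =
        GammaT t r.1.1 r.1.2 + t 0 * Real.cos ϑ₂ * OmegaBar r.1.1 r.1.2) ∧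
    -- singular points in `U₁` with `dJ ≠ 0` have `v = 0`, i.e. `ϑ₂ ∈ {0, π}`
    (∀ w : V1, IsSingular t (phi1 w) → dJNonzero (phi1 w) → w.1.2.im = 0) ∧
    (∀ (r : D1) (ϑ₁ ϑ₂ : ℝ), -Real.pi < ϑ₂ → ϑ₂ ≤ Real.pi →
      IsSingular t (phiPolar r ϑ₁ ϑ₂) → dJNonzero (phiPolar r ϑ₁ ϑ₂) →
      ϑ₂ = 0 ∨ ϑ₂ = Real.pi) ∧
    -- solutions of the equation with `r₁ ≠ 0` give rank one singular points
    (∀ r : D1, r.1.1 ≠ 0 → singExpr t r.1.1 r.1.2 = 0 →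
      ∃ ϑ₂ : ℝ, (ϑ₂ = 0 ∨ ϑ₂ = Real.pi) ∧
        ∀ ϑ₁ : ℝ, IsRankOneSingular t (phiPolar r ϑ₁ ϑ₂)) ∧
    -- which of the two angles occurs
    (∀ r : D1, r.1.1 ≠ 0 → ∀ ϑ₁ ϑ₂ : ℝ, (ϑ₂ = 0 ∨ ϑ₂ = Real.pi) →
      (IsRankOneSingular t (phiPolar r ϑ₁ ϑ₂) ↔
        dGammaT t r.1.1 r.1.2 + t 0 * Real.cos ϑ₂ * dOmegaBar r.1.1 r.1.2 = 0)) ∧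
    -- every singular point in `U₁` with `dJ ≠ 0` comes from a solution of the equation
    (∀ w : V1, IsSingular t (phi1 w) → dJNonzero (phi1 w) →
      IsRankOneSingular t (phi1 w) ∧ ‖w.1.1‖ ≠ 0 ∧ singExpr t ‖w.1.1‖ ‖w.1.2‖ = 0) ∧
    -- on `D₁` the equation is equivalent to a polynomial equation, after clearing denominators
    (∃ Q : MvPolynomial (Fin 2) ℝ, Q ≠ 0 ∧
      ∀ r : D1, 0 < fiveProd r.1.1 r.1.2 ∧
        fiveProd r.1.1 r.1.2 * singExpr t r.1.1 r.1.2 = MvPolynomial.eval ![r.1.1, r.1.2] Q) := by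
  refine ⟨range_phi1, phiPolar_values t, fun w hs hJ =>
    (im_eq_zero_and_critFun_of_isSingular ht hs (fst_ne_zero_of_dJNonzero hJ)).1, ?_, ?_,
    fun r hr ϑ₁ ϑ₂ h2 => phiPolar_isRankOneSingular_iff r hr ϑ₁ h2, ?_,
    exists_poly_fiveProd_mul_singExpr ht⟩
  · intro r ϑ₁ ϑ₂ hlo hhi hs hJ
    obtain ⟨hv, -, hc⟩ := im_eq_zero_and_critFun_of_isSingular ht hs (fst_ne_zero_of_dJNonzero hJ)
    obtain ⟨p1, p2⟩ := polar1_snd r.1 ϑ₁ ϑ₂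
    rw [p2] at hv
    rcases mul_eq_zero.1 hv with h0 | hsin
    -- At `r₂ = 0` the angle is arbitrary, but there `critFun` equals `t₁ S / 50 ≠ 0`, so no such
    -- point is singular.
    · rw [p1, h0, zero_mul] at hc
      have hpos := D1_fiveProd_pos r.2
      rw [h0, ← (norm_polar1 r.2 ϑ₁ ϑ₂).1] at hpos
      exact absurd hc (critFun_zero_ne_zero ht hpos)
    · rcases lt_or_ge ϑ₂ Real.pi with hlt | hge
      · exact Or.inl ((Real.sin_eq_zero_iff_of_lt_of_lt hlo hlt).1 hsin)
      · exact Or.inr (le_antisymm hhi hge)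
  · intro r hr he
    rcases add_mul_cos_eq_zero_or_of_sq he with h | h
    · exact ⟨0, Or.inl rfl, fun ϑ₁ => (phiPolar_isRankOneSingular_iff r hr ϑ₁ (Or.inl rfl)).2 h⟩
    · exact ⟨Real.pi, Or.inr rfl,
        fun ϑ₁ => (phiPolar_isRankOneSingular_iff r hr ϑ₁ (Or.inr rfl)).2 h⟩
  · intro w hs hJ
    have h1 := fst_ne_zero_of_dJNonzero hJ
    obtain ⟨hv, hr, hc⟩ := im_eq_zero_and_critFun_of_isSingular ht hs h1
    exact ⟨hr, norm_ne_zero_iff.2 h1, singExpr_eq_zero_of_critFun w.2 hv hc⟩
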